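/- Let $b>0$ and let $L=(L_t:t\ge 0)$ be a Lévy subordinator (a real-valued Lévy process with $L_0=0$ and almost surely nondecreasing paths). For every $n\ge 2$ consider a mixed coherent system with $n$ components, i.e. a random structure function $\Phi^{(n)}:\{0,1\}^n\to\{0,1\}$ that takes values in the coherent structure functions (componentwise nondecreasing and without irrelevant components). Its signature is $s^{(n)}_k=\phi^{(n)}_{n-k+1}-\phi^{(n)}_{n-k}$, $k=1,\dots,n$, where $$\phi^{(n)}_{m}=\binom{n}{m}^{-1}\sum_{x\in\{0,1\}^n,\ |x|=m}\mathbb{E}\,\Phi^{(n)}(x).$$ Assume that $$s^{(n)}_k=C^{(n)}k^{b-1},\qquad k=1,\dots,n,$$ where $C^{(n)}$ is the constant for which $\sum_{k=1}^n C^{(n)}k^{b-1}=1$. Assume further that the vector of component failure times $(T^{(n)}_1,\dots,T^{(n)}_n)$ is independent of $\Phi^{(n)}$ and has the Lévy-frailty Marshall–Olkin distribution with underlying subordinator $L$ (the same for all $n$), i.e. it has the law of the vector with entries $\inf\{t\ge 0: L_t>\varepsilon_i\}\in[0,\infty]$, $i=1,\dots,n$, where $\varepsilon_1,\dots,\varepsilon_n$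 are i.i.d. standard exponential random variables independent of $L$. Let $T^{(n)}_{\mathrm{sys}}$ be the failure time of the $n$-th system, i.e. the first time $t\ge 0$ at which $\Phi^{(n)}\big((\mathbf 1_{\{T^{(n)}_i>t\}})_{i=1}^n\big)=0$. Then for every $t>0$ the reliability function satisfies $$\mathbb{P}\big(T^{(n)}_{\mathrm{sys}}>t\big)\longrightarrow 1-\mathbb{E}\big[(1-e^{-L_t})^b\big]\qquad\text{as } n\to+\infty .$$ -/

import Mathlib

open MeasureTheory ProbabilityTheory Filter Topology
open scoped ENNReal NNReal

namespace Reliability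

/-- A structure function of a system with `n` components: a configuration `x` records which
components are working (`true`) or failed (`false`), and the value says whether the system works. -/
abbrev StructureFunction (n : ℕ) : Type := (Fin n → Bool) → Bool

/-- Component `i` is irrelevant if its state never affects the state of the system. -/
def IsIrrelevant {n : ℕ} (Φ : StructureFunction n) (i : Fin n) : Prop :=
  ∀ x : Fin n → Bool, Φ (Function.update x i false) = Φ (Function.update x i true)

/-- A coherent system: monotone, and without irrelevant components. -/
structure IsCoherent {n : ℕ} (Φ : StructureFunction n) : Prop where
  mono : ∀ (i : Fin n) (x : Fin n → Bool),
    Φ (Function.update x i false) ≤ Φ (Function.update x i true)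
  relevant : ∀ i : Fin n, ¬ IsIrrelevant Φ i

/-- A mixed coherent system: a random structure function that is a randomized choice among the
(finitely many) coherent ones, with arbitrary probabilities. -/
structure IsMixedCoherent {Ω : Type*} [MeasurableSpace Ω] {n : ℕ}
    (Φ : Ω → StructureFunction n) (μ : Measure Ω) : Prop where
  measurable : Measurable Φ
  coherent : ∀ᵐ ω ∂μ, IsCoherent (Φ ω)

/-- `φ_m`: the expected proportion, among the configurations with exactly `m` working components,
of those for which the system works. -/
noncomputable def workingProportion {Ω : Type*} [MeasurableSpace Ω] {n : ℕ}
    (Φ : Ω → StructureFunction n) (μ : Measure Ω) (m : ℕ) : ℝ :=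
  (∑ x : Fin n → Bool with (Finset.univ.filter fun i => x i = true).card = m,
    ∫ ω, (if Φ ω x = true then (1 : ℝ) else 0) ∂μ) / (n.choose m : ℝ)

/-- The `k`-th entry `s_k = φ_{n-k+1} - φ_{n-k}` of the signature, for `k = 1, …, n`. -/
noncomputable def signature {Ω : Type*} [MeasurableSpace Ω] {n : ℕ}
    (Φ : Ω → StructureFunction n) (μ : Measure Ω) (k : ℕ) : ℝ :=
  workingProportion Φ μ (n - k + 1) - workingProportion Φ μ (n - k)

/-- The failure time of a system with structure function `Φ` and component failure times `τ`:
the first time at which the system is not working, where component `i` works at time `t`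
if and only if `t < τ i`. -/
noncomputable def systemFailureTime {n : ℕ} (Φ : StructureFunction n) (τ : Fin n → ℝ≥0∞) : ℝ≥0∞ :=
  sInf {t : ℝ≥0∞ | Φ (fun i => decide (t < τ i)) = false}

/-- A Lévy subordinator: a real-valued process started at `0` with independent and stationary
increments whose paths are almost surely nondecreasing and right-continuous
(left limits then exist automatically). -/
structure IsLevySubordinator {Ω : Type*} [MeasurableSpace Ω]
    (L : ℝ≥0 → Ω → ℝ) (P : Measure Ω) : Prop where
  measurable : ∀ t, Measurable (L t)
  zero : ∀ᵐ ω ∂P, L 0 ω = 0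
  indep : HasIndepIncrements L P
  stationary : ∀ s t : ℝ≥0, IdentDistrib (fun ω => L (s + t) ω - L s ω) (L t) P P
  mono : ∀ᵐ ω ∂P, Monotone fun t => L t ω
  rightCont : ∀ᵐ ω ∂P, ∀ t, ContinuousWithinAt (fun u => L u ω) (Set.Ici t) t

/-- The first passage time `inf {t ≥ 0 : ℓ t > e}` of a path above the level `e`, equal to `∞`
if the path never exceeds `e`. -/
noncomputable def firstPassageTime (ℓ : ℝ≥0 → ℝ) (e : ℝ) : ℝ≥0∞ :=
  ⨅ (t : ℝ≥0) (_ : e < ℓ t), (t : ℝ≥0∞)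

/-- The Lévy-frailty Marshall–Olkin distribution in dimension `n` with underlying subordinator `L`:
the joint law of `T_i = inf {t ≥ 0 : L_t > ε_i}`, `i = 1, …, n`, where the `ε_i` are independent
standard exponential variables that are independent of `L`. The pair `(L, ε)` is realized on the
product of the probability space of `L` and of `ℝⁿ` with the product of exponential laws. -/
noncomputable def lfmoLaw {Ω : Type*} [MeasurableSpace Ω] (L : ℝ≥0 → Ω → ℝ) (P : Measure Ω)
    (n : ℕ) : Measure (Fin n → ℝ≥0∞) :=
  (P.prod (Measure.pi fun _ : Fin n => expMeasure 1)).map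
    fun z i => firstPassageTime (fun t => L t z.1) (z.2 i)

end Reliability

open Reliability

/-! Condition on `L` and put `p = exp (-L t)`, `q = 1 - p`. At time `t` the components work
independently with probability `p`, so the conditional reliability is the sum over `m` of `φ_m`
times a binomial weight. Coherence gives `φ_0 = 0`, and telescoping the signature gives `φ_m = 1 -
S_{n-m} / S_n` with `S` the power sum. Counting failed components instead, the conditional failure
probability is a Bernstein-type sum in `q` with coefficients `S_i / S_n`. Since `S_i / S_n` is close
to `(i / n) ^ b` uniformly in `i ≤ n`, this sum is close to the Bernstein polynomial of `x ^ b`,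
hence tends to `q ^ b` uniformly on `[0, 1]` (`tendstoUniformlyOn_powerSum_bernstein`). Uniformity
lets the limit pass through the expectation over `L`. -/

namespace Reliability

/-! ### Power sums and Bernstein approximation -/

/-- The partial sums `∑_{k=1}^m k^{b-1}`. -/
noncomputable def powerSum (b : ℝ) (m : ℕ) : ℝ :=
  ∑ k ∈ Finset.range m, ((k : ℝ) + 1) ^ (b - 1)

theorem powerSum_succ (b : ℝ) (m : ℕ) :
    powerSum b (m + 1) = powerSum b m + ((m : ℝ) + 1) ^ (b - 1) :=
  Finset.sum_range_succ _ _

theorem powerSum_zero (b : ℝ) : powerSum b 0 = 0 := by simp [powerSum]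

theorem powerSum_nonneg (b : ℝ) (m : ℕ) : 0 ≤ powerSum b m :=
  Finset.sum_nonneg fun k _ => by positivity

theorem powerSum_mono (b : ℝ) : Monotone (powerSum b) :=
  monotone_nat_of_le_succ fun m => by
    rw [powerSum_succ]
    have : 0 ≤ ((m : ℝ) + 1) ^ (b - 1) := by positivity
    linarith

theorem powerSum_pos (b : ℝ) {m : ℕ} (hm : 0 < m) : 0 < powerSum b m :=
  Finset.sum_pos (fun k _ => by positivity) (by simpa using hm.ne')

theorem exists_rpow_succ_sub_rpow {b : ℝ} (hb : 0 < b) (m : ℕ) :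
    ∃ ξ ∈ Set.Ioo (m : ℝ) (m + 1), ((m : ℝ) + 1) ^ b - (m : ℝ) ^ b = b * ξ ^ (b - 1) := by
  have hm : (0 : ℝ) ≤ m := m.cast_nonneg
  obtain ⟨ξ, hξ, h⟩ := exists_hasDerivAt_eq_slope (fun x : ℝ => x ^ b)
    (fun x => b * x ^ (b - 1)) (lt_add_one (m : ℝ))
    (Real.continuous_rpow_const hb.le).continuousOn
    (fun x hx => Real.hasDerivAt_rpow_const (Or.inl (hm.trans_lt hx.1).ne'))
  exact ⟨ξ, hξ, by rw [h]; simp⟩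

/-- Sum-integral comparison: by the mean value theorem each increment of `x ^ b` is `b * ξ ^ (b -
1)`, and monotonicity of `x ^ (b - 1)`, whose direction depends on whether `b ≥ 1`, compares it with
a term of the sum. The bound uses `n` so as to be uniform in `m`. -/
theorem abs_mul_powerSum_sub_rpow_le {b : ℝ} (hb : 0 < b) {m n : ℕ} (hmn : m ≤ n) :
    |b * powerSum b m - (m : ℝ) ^ b| ≤ 1 + b * (n : ℝ) ^ (b - 1) := by
  rcases le_total 1 b with h1 | h1
  · have key : (m : ℝ) ^ b ≤ b * powerSum b m ∧
        b * powerSum b m ≤ (m : ℝ) ^ b + b * (m : ℝ) ^ (b - 1) := by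
      clear hmn
      induction m with
      | zero =>
        simp only [powerSum_zero, Nat.cast_zero, Real.zero_rpow hb.ne']
        refine ⟨by simp, ?_⟩
        have : (0 : ℝ) ≤ 0 ^ (b - 1) := Real.rpow_nonneg le_rfl _
        nlinarith
      | succ m ih =>
        obtain ⟨ξ, hξ, h⟩ := exists_rpow_succ_sub_rpow hb m
        have hm : (0 : ℝ) ≤ m := m.cast_nonneg
        have l1 : ξ ^ (b - 1) ≤ ((m : ℝ) + 1) ^ (b - 1) :=
          Real.rpow_le_rpow (hm.trans hξ.1.le) hξ.2.le (by linarith)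
        have l2 : (m : ℝ) ^ (b - 1) ≤ ξ ^ (b - 1) :=
          Real.rpow_le_rpow hm hξ.1.le (by linarith)
        have l3 := mul_le_mul_of_nonneg_left l1 hb.le
        have l4 := mul_le_mul_of_nonneg_left l2 hb.le
        rw [powerSum_succ]
        push_cast
        constructor <;> linarith [ih.1, ih.2]
    have hmono : (m : ℝ) ^ (b - 1) ≤ (n : ℝ) ^ (b - 1) :=
      Real.rpow_le_rpow m.cast_nonneg (by exact_mod_cast hmn) (by linarith)
    have hmono' := mul_le_mul_of_nonneg_left hmono hb.le
    rw [abs_le]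
    constructor <;> linarith [key.1, key.2]
  · have key : b * powerSum b m ≤ (m : ℝ) ^ b := by
      clear hmn
      induction m with
      | zero => simp [powerSum_zero, Real.zero_rpow hb.ne']
      | succ m ih =>
        obtain ⟨ξ, hξ, h⟩ := exists_rpow_succ_sub_rpow hb m
        have hm : (0 : ℝ) ≤ m := m.cast_nonneg
        have l1 : ((m : ℝ) + 1) ^ (b - 1) ≤ ξ ^ (b - 1) :=
          Real.rpow_le_rpow_of_nonpos (hm.trans_lt hξ.1) hξ.2.le (by linarith)
        have l3 := mul_le_mul_of_nonneg_left l1 hb.le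
        rw [powerSum_succ]
        push_cast
        linarith
    -- The shift by one avoids the interval `(0, 1)`, where `ξ ^ (b - 1)` may be unbounded; that
    -- interval contributes the constant `1`.
    have key' : ((m : ℝ) + 1) ^ b ≤ b * powerSum b m + 1 := by
      clear hmn key
      induction m with
      | zero => simp [powerSum_zero]
      | succ m ih =>
        obtain ⟨ξ, hξ, h⟩ := exists_rpow_succ_sub_rpow hb (m + 1)
        push_cast at hξ h ⊢
        have hm : (0 : ℝ) ≤ m := m.cast_nonneg
        have l1 : ξ ^ (b - 1) ≤ ((m : ℝ) + 1) ^ (b - 1) :=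
          Real.rpow_le_rpow_of_nonpos (by linarith) hξ.1.le (by linarith)
        have l3 := mul_le_mul_of_nonneg_left l1 hb.le
        rw [powerSum_succ]
        linarith
    have hle : (m : ℝ) ^ b ≤ ((m : ℝ) + 1) ^ b :=
      Real.rpow_le_rpow m.cast_nonneg (by linarith) hb.le
    have : 0 ≤ b * (n : ℝ) ^ (b - 1) := by positivity
    rw [abs_le]
    constructor <;> linarith

theorem abs_powerSum_div_sub_le {b : ℝ} (hb : 0 < b) {m n : ℕ} (hn : 0 < n) (hmn : m ≤ n) :
    |powerSum b m / powerSum b n - ((m : ℝ) / n) ^ b| ≤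
      2 * ((1 + b * (n : ℝ) ^ (b - 1)) / (n : ℝ) ^ b) := by
  have hn' : (0 : ℝ) < n := by exact_mod_cast hn
  set N : ℝ := (n : ℝ) ^ b with hN
  have hNpos : 0 < N := by positivity
  set E : ℝ := 1 + b * (n : ℝ) ^ (b - 1)
  have h1 : |b * powerSum b m - (m : ℝ) ^ b| ≤ E := abs_mul_powerSum_sub_rpow_le hb hmn
  have h2 : |b * powerSum b n - N| ≤ E := abs_mul_powerSum_sub_rpow_le hb le_rfl
  have hS := powerSum_pos b hn
  have hr0 : 0 ≤ powerSum b m / powerSum b n := div_nonneg (powerSum_nonneg b m) hS.le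
  have hr1 : powerSum b m / powerSum b n ≤ 1 := (div_le_one hS).2 (powerSum_mono b hmn)
  -- Numerator and denominator each contribute an error of at most `E`, the latter multiplied by a
  -- ratio at most `1`; hence the factor `2`.
  have heq : powerSum b m / powerSum b n - ((m : ℝ) / n) ^ b =
      ((b * powerSum b m - (m : ℝ) ^ b) -
        powerSum b m / powerSum b n * (b * powerSum b n - N)) / N := by
    rw [Real.div_rpow m.cast_nonneg hn'.le, ← hN]
    field_simp
    ring
  rw [heq, abs_div, abs_of_pos hNpos, ← mul_div_assoc]
  refine div_le_div_of_nonneg_right ((abs_sub _ _).trans ?_) hNpos.le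
  rw [abs_mul, abs_of_nonneg hr0]
  have := mul_le_mul hr1 h2 (abs_nonneg _) zero_le_one
  linarith

theorem tendsto_powerSum_error {b : ℝ} (hb : 0 < b) :
    Tendsto (fun n : ℕ => 2 * ((1 + b * (n : ℝ) ^ (b - 1)) / (n : ℝ) ^ b)) atTop (𝓝 0) := by
  have h1 : Tendsto (fun n : ℕ => ((n : ℝ) ^ b)⁻¹) atTop (𝓝 0) :=
    ((tendsto_rpow_atTop hb).comp tendsto_natCast_atTop_atTop).inv_tendsto_atTop
  have h2 : Tendsto (fun n : ℕ => ((n : ℝ))⁻¹) atTop (𝓝 0) := tendsto_inv_atTop_nhds_zero_nat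
  have h3 := (h1.add (h2.const_mul b)).const_mul 2
  simp only [mul_zero, add_zero] at h3
  refine h3.congr' ?_
  filter_upwards [eventually_gt_atTop 0] with n hn
  have hn' : (0 : ℝ) < n := by exact_mod_cast hn
  rw [Real.rpow_sub_one hn'.ne']
  field_simp

/-- Bernstein weights are nonnegative and sum to `1`, so a uniform error in the coefficients gives
the same error in the sum. The rest is Bernstein's theorem for `x ^ b`. -/
theorem tendstoUniformlyOn_powerSum_bernstein {b : ℝ} (hb : 0 < b) :
    TendstoUniformlyOn
      (fun (n : ℕ) (q : ℝ) => ∑ i ∈ Finset.range (n + 1),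
        powerSum b i / powerSum b n * ((n.choose i : ℝ) * q ^ i * (1 - q) ^ (n - i)))
      (fun q => q ^ b) atTop (Set.Icc 0 1) := by
  rw [Metric.tendstoUniformlyOn_iff]
  intro ε hε
  let f : C(unitInterval, ℝ) :=
    ⟨fun q => (q : ℝ) ^ b, (Real.continuous_rpow_const hb.le).comp continuous_subtype_val⟩
  have hB := Metric.tendsto_nhds.1 (bernsteinApproximation_uniform f) (ε / 2) (half_pos hε)
  have hE := (tendsto_powerSum_error hb).eventually (gt_mem_nhds (half_pos hε))
  filter_upwards [hB, hE, eventually_gt_atTop 0] with n hn1 hn2 hn q hq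
  have h1 := (ContinuousMap.dist_apply_le_dist (⟨q, hq⟩ : unitInterval)).trans_lt hn1
  rw [bernsteinApproximation.apply] at h1
  have hf : f ⟨q, hq⟩ = q ^ b := rfl
  rw [hf, dist_comm] at h1
  refine (dist_triangle _ _ _).trans_lt
    ((add_lt_add_of_lt_of_le h1 (?_ : _ ≤ ε / 2)).trans_eq (add_halves ε))
  rw [Finset.sum_range, Real.dist_eq, ← Finset.sum_sub_distrib]
  refine (Finset.abs_sum_le_sum_abs _ _).trans ?_
  calc _ ≤ ∑ k : Fin (n + 1), bernstein n k ⟨q, hq⟩ * (ε / 2) := by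
        refine Finset.sum_le_sum fun k _ => ?_
        rw [← bernstein_apply n k ⟨q, hq⟩, mul_comm _ (bernstein n k ⟨q, hq⟩), smul_eq_mul,
          ← mul_sub, abs_mul, abs_of_nonneg bernstein_nonneg]
        refine mul_le_mul_of_nonneg_left ?_ bernstein_nonneg
        rw [abs_sub_comm]
        exact (abs_powerSum_div_sub_le hb hn (Nat.lt_succ_iff.1 k.2)).trans hn2.le
    _ = ε / 2 := by
        rw [← Finset.sum_mul, bernstein.probability, one_mul]

end Reliability

/-! ### Coherent systems, passage times and the Lévy-frailty law -/

namespace Reliability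

theorem IsCoherent.monotone {n : ℕ} {Φ : StructureFunction n} (h : IsCoherent Φ) :
    Monotone Φ := by
  classical
  intro x y hxy
  -- Move from `x` to `y` one coordinate at a time.
  suffices H : ∀ s : Finset (Fin n), Φ x ≤ Φ (s.piecewise y x) by simpa using H Finset.univ
  intro s
  induction s using Finset.induction_on with
  | empty => simp
  | insert j s hj ih =>
    refine ih.trans ?_
    rw [Finset.piecewise_insert]
    set z := s.piecewise y x
    have hz : z j = x j := Finset.piecewise_eq_of_notMem _ _ _ hj
    have hle := hxy j
    have hself : Function.update z j (x j) = z := by rw [← hz, Function.update_eq_self]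
    cases hx : x j <;> cases hy : y j <;> rw [hx] at hself <;> rw [hx, hy] at hle
    · rw [hself]
    · conv_lhs => rw [← hself]
      exact h.mono j z
    · exact absurd (hle rfl) Bool.false_ne_true
    · rw [hself]

/-- Otherwise monotonicity makes `Φ` constantly true and every component irrelevant. -/
theorem IsCoherent.apply_false {n : ℕ} {Φ : StructureFunction n} (h : IsCoherent Φ)
    (hn : 0 < n) : Φ (fun _ => false) = false := by
  by_contra hne
  rw [Bool.not_eq_false] at hne
  have htrue : ∀ x, Φ x = true := fun x => by
    have := h.monotone (show (fun _ => false) ≤ x from fun i => Bool.false_le _)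
    rw [hne] at this
    exact top_le_iff.1 this
  exact h.relevant ⟨0, hn⟩ fun x => by rw [htrue, htrue]

/-- A coherent system works at time `t` iff it fails strictly after `t`. -/
theorem IsCoherent.lt_systemFailureTime_iff {n : ℕ} {Φ : StructureFunction n}
    (h : IsCoherent Φ) (τ : Fin n → ℝ≥0∞) {t : ℝ≥0∞} (ht : t < ∞) :
    t < systemFailureTime Φ τ ↔ Φ (fun i => decide (t < τ i)) = true := by
  constructor
  · intro hlt
    by_contra hne
    rw [Bool.not_eq_true] at hne
    exact hlt.not_ge (sInf_le hne)
  · intro hΦ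
    -- The earliest failure among components working at `t`, or `∞` if there are none. Before `m`
    -- all of them still work, so by monotonicity the system does too.
    let m : ℝ≥0∞ := (Finset.univ.filter fun i => t < τ i).inf τ
    have hm : t < m := (Finset.lt_inf_iff ht).2 fun i hi => (Finset.mem_filter.1 hi).2
    refine hm.trans_le (le_sInf fun s hs => ?_)
    by_contra hsm
    rw [not_le] at hsm
    have hle : (fun i => decide (t < τ i)) ≤ fun i => decide (s < τ i) := fun i => by
      by_cases hi : t < τ i
      · have : s < τ i := hsm.trans_le (Finset.inf_le (by simpa using hi))
        simp [hi, this]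
      · simp [hi]
    have := h.monotone hle
    rw [hΦ, show Φ (fun i => decide (s < τ i)) = false from hs] at this
    exact absurd this (by decide)

/-- Right-continuity keeps the path below `e` just after `t`. The level `e = ℓ t` is excluded
because a path that is flat after `t` passes it only later. -/
theorem lt_firstPassageTime_iff {ℓ : ℝ≥0 → ℝ} (hmono : Monotone ℓ) {t : ℝ≥0}
    (hcont : ContinuousWithinAt ℓ (Set.Ici t) t) {e : ℝ} (he : e ≠ ℓ t) :
    (t : ℝ≥0∞) < firstPassageTime ℓ e ↔ ℓ t < e := by
  constructor
  · intro h
    refine lt_of_le_of_ne (not_lt.1 fun hlt => ?_) he.symm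
    exact h.not_ge (iInf₂_le t hlt)
  · intro h
    have h1 : ∀ᶠ u in 𝓝[>] t, ℓ u < e :=
      (hcont.mono Set.Ioi_subset_Ici_self).eventually (gt_mem_nhds h)
    obtain ⟨u, hu, htu⟩ := (h1.and self_mem_nhdsWithin).exists
    refine lt_of_lt_of_le (ENNReal.coe_lt_coe.2 htu) (le_iInf₂ fun s hs => ?_)
    rw [ENNReal.coe_le_coe]
    by_contra hsu
    exact (hs.trans_le (hmono (not_le.1 hsu).le)).not_gt hu

/-- A right-continuous path above `e` stays above it for a while, so a dense set of times suffices.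
The countable infimum yields measurability. -/
theorem firstPassageTime_eq_iInf_denseSeq {ℓ : ℝ≥0 → ℝ}
    (hcont : ∀ t, ContinuousWithinAt ℓ (Set.Ici t) t) (e : ℝ) :
    firstPassageTime ℓ e = ⨅ (k : ℕ) (_ : e < ℓ (TopologicalSpace.denseSeq ℝ≥0 k)),
      (TopologicalSpace.denseSeq ℝ≥0 k : ℝ≥0∞) := by
  refine le_antisymm (le_iInf₂ fun k hk =>
    iInf₂_le (f := fun (t : ℝ≥0) (_ : e < ℓ t) => (t : ℝ≥0∞)) _ hk) (le_iInf₂ fun t ht => ?_)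
  refine le_of_forall_gt fun c hc => ?_
  have h1 : ∀ᶠ u in 𝓝[>] t, e < ℓ u :=
    ((hcont t).mono Set.Ioi_subset_Ici_self).eventually (lt_mem_nhds ht)
  have h2 : ∀ᶠ u : ℝ≥0 in 𝓝[>] t, (u : ℝ≥0∞) < c :=
    nhdsWithin_le_nhds ((ENNReal.continuous_coe.tendsto t).eventually (gt_mem_nhds hc))
  obtain ⟨v, hv, hsub⟩ := mem_nhdsGT_iff_exists_Ioo_subset.1 (h1.and h2)
  obtain ⟨k, hk⟩ := (TopologicalSpace.denseRange_denseSeq ℝ≥0).exists_mem_open isOpen_Ioo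
    (Set.nonempty_Ioo.2 hv)
  exact (iInf₂_le k (hsub hk).1).trans_lt (hsub hk).2

theorem IsLevySubordinator.nonneg {Ω : Type*} [MeasurableSpace Ω] {P : Measure Ω}
    {L : ℝ≥0 → Ω → ℝ} (hL : IsLevySubordinator L P) (t : ℝ≥0) : ∀ᵐ ω ∂P, 0 ≤ L t ω := by
  filter_upwards [hL.zero, hL.mono] with ω h0 hm
  rw [← h0]
  exact hm (zero_le (a := t))

theorem IsLevySubordinator.aemeasurable_firstPassageTime {Ω : Type*} [MeasurableSpace Ω]
    {P : Measure Ω} {L : ℝ≥0 → Ω → ℝ} (hL : IsLevySubordinator L P)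
    {n : ℕ} (ν : Measure (Fin n → ℝ)) [SFinite ν] :
    AEMeasurable (fun z : Ω × (Fin n → ℝ) => fun i =>
      firstPassageTime (fun t => L t z.1) (z.2 i)) (P.prod ν) := by
  refine ⟨fun z i => ⨅ (k : ℕ) (_ : z.2 i < L (TopologicalSpace.denseSeq ℝ≥0 k) z.1),
      (TopologicalSpace.denseSeq ℝ≥0 k : ℝ≥0∞), ?_, ?_⟩
  · refine measurable_pi_lambda _ fun i => Measurable.iInf fun k => ?_
    have hset : MeasurableSet {z : Ω × (Fin n → ℝ) |
        z.2 i < L (TopologicalSpace.denseSeq ℝ≥0 k) z.1} :=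
      measurableSet_lt ((measurable_pi_apply i).comp measurable_snd)
        ((hL.measurable _).comp measurable_fst)
    classical
    simp only [iInf_eq_if]
    exact Measurable.ite hset measurable_const measurable_const
  · filter_upwards [Measure.quasiMeasurePreserving_fst.ae hL.rightCont] with z hz
    funext i
    exact firstPassageTime_eq_iInf_denseSeq hz _

theorem expMeasure_real_Ioi {a : ℝ} (ha : 0 ≤ a) :
    (expMeasure 1).real (Set.Ioi a) = Real.exp (-a) := by
  have := isProbabilityMeasure_expMeasure one_pos
  have h := cdf_expMeasure_eq one_pos a
  rw [cdf_eq_real, if_pos ha, one_mul] at h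
  rw [← Set.compl_Iic, probReal_compl_eq_one_sub measurableSet_Iic, h]
  ring

instance nullSingletonClass_expMeasure : NullSingletonClass (expMeasure 1) := by
  unfold expMeasure gammaMeasure
  infer_instance

theorem measurable_workingComponents (n : ℕ) (t : ℝ≥0∞) :
    Measurable fun (τ : Fin n → ℝ≥0∞) (i : Fin n) => decide (t < τ i) := by
  refine measurable_pi_lambda _ fun i => measurable_to_bool ?_
  have : (fun τ : Fin n → ℝ≥0∞ => decide (t < τ i)) ⁻¹' {true} = {τ | t < τ i} := by
    ext; simp
  rw [this]
  exact measurableSet_lt measurable_const (measurable_pi_apply i)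

theorem pi_expMeasure_real {n : ℕ} (x : Fin n → Bool) {a : ℝ} (ha : 0 ≤ a) :
    (Measure.pi fun _ : Fin n => expMeasure 1).real {e | (fun i => decide (a < e i)) = x} =
      Real.exp (-a) ^ (Finset.univ.filter fun i => x i = true).card *
        (1 - Real.exp (-a)) ^ (n - (Finset.univ.filter fun i => x i = true).card) := by
  have := isProbabilityMeasure_expMeasure one_pos
  have hset : {e : Fin n → ℝ | (fun i => decide (a < e i)) = x} =
      Set.univ.pi fun i => if x i = true then Set.Ioi a else Set.Iic a := by
    ext e
    simp only [Set.mem_ofPred_eq, Set.mem_univ_pi, funext_iff]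
    refine forall_congr' fun i => ?_
    cases x i <;> simp
  rw [hset, measureReal_def, Measure.pi_pi, ENNReal.toReal_prod]
  have hval : ∀ i, ((expMeasure 1) (if x i = true then Set.Ioi a else Set.Iic a)).toReal =
      if x i = true then Real.exp (-a) else 1 - Real.exp (-a) := fun i => by
    rw [← measureReal_def]
    split_ifs
    · exact expMeasure_real_Ioi ha
    · rw [← Set.compl_Ioi, probReal_compl_eq_one_sub measurableSet_Ioi, expMeasure_real_Ioi ha]
  simp_rw [hval]
  rw [Finset.prod_ite, Finset.prod_const, Finset.prod_const]
  congr 2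
  have := Finset.card_filter_add_card_filter_not (s := (Finset.univ : Finset (Fin n)))
    (fun i => x i = true)
  rw [Finset.card_univ, Fintype.card_fin] at this
  omega

/-- Under the Lévy-frailty Marshall–Olkin law, the components working at time `t` are
conditionally independent given `L`, each working with probability `exp (-L t)`. -/
theorem lfmoLaw_real_workingComponents {Ω : Type*} [MeasurableSpace Ω] {P : Measure Ω}
    [IsProbabilityMeasure P] {L : ℝ≥0 → Ω → ℝ} (hL : IsLevySubordinator L P) {n : ℕ}
    (t : ℝ≥0) (x : Fin n → Bool) :
    (lfmoLaw L P n).real {τ | (fun i => decide ((t : ℝ≥0∞) < τ i)) = x} =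
      ∫ ω, Real.exp (-L t ω) ^ (Finset.univ.filter fun i => x i = true).card *
        (1 - Real.exp (-L t ω)) ^ (n - (Finset.univ.filter fun i => x i = true).card) ∂P := by
  have := isProbabilityMeasure_expMeasure one_pos
  let ν : Measure (Fin n → ℝ) := Measure.pi fun _ : Fin n => expMeasure 1
  have hmeas : MeasurableSet {τ : Fin n → ℝ≥0∞ | (fun i => decide ((t : ℝ≥0∞) < τ i)) = x} :=
    measurable_workingComponents n t (measurableSet_singleton x)
  have hlt (i : Fin n) : MeasurableSet {z : Ω × (Fin n → ℝ) | L t z.1 < z.2 i} :=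
    measurableSet_lt ((hL.measurable t).comp measurable_fst)
      ((measurable_pi_apply i).comp measurable_snd)
  have hmeas' : MeasurableSet
      {z : Ω × (Fin n → ℝ) | (fun i => decide (L t z.1 < z.2 i)) = x} := by
    have : Measurable fun (z : Ω × (Fin n → ℝ)) (i : Fin n) => decide (L t z.1 < z.2 i) := by
      refine measurable_pi_lambda _ fun i => measurable_to_bool ?_
      convert! hlt i using 1
      ext; simp
    exact this (measurableSet_singleton x)
  -- By Fubini, since the exponential law has no atoms.
  have hne : ∀ᵐ z ∂(P.prod ν), ∀ i, z.2 i ≠ L t z.1 := by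
    rw [ae_all_iff]
    intro i
    refine (Measure.ae_prod_iff_ae_ae ?_).2 (ae_of_all _ fun ω => ?_)
    · exact (measurableSet_eq_fun ((measurable_pi_apply i).comp measurable_snd)
        ((hL.measurable t).comp measurable_fst)).compl
    · exact (Measure.quasiMeasurePreserving_eval (fun _ : Fin n => expMeasure 1) i).ae
        (Measure.ae_ne _ (L t ω))
  have hae : {z : Ω × (Fin n → ℝ) |
        (fun i => decide ((t : ℝ≥0∞) < firstPassageTime (fun s => L s z.1) (z.2 i))) = x}
      =ᵐ[P.prod ν] {z | (fun i => decide (L t z.1 < z.2 i)) = x} := by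
    filter_upwards [Measure.quasiMeasurePreserving_fst.ae hL.rightCont,
      Measure.quasiMeasurePreserving_fst.ae hL.mono, hne] with z h1 h2 h3
    have : (fun i => decide ((t : ℝ≥0∞) < firstPassageTime (fun s => L s z.1) (z.2 i))) =
        fun i => decide (L t z.1 < z.2 i) := by
      funext i
      simp only [lt_firstPassageTime_iff h2 (h1 t) (h3 i)]
    apply propext
    change _ = x ↔ _ = x
    rw [this]
  rw [lfmoLaw, measureReal_def,
    Measure.map_apply_of_aemeasurable (hL.aemeasurable_firstPassageTime _) hmeas]
  change ((P.prod ν) {z : Ω × (Fin n → ℝ) |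
        (fun i => decide ((t : ℝ≥0∞) < firstPassageTime (fun s => L s z.1) (z.2 i))) = x}).toReal = _
  rw [measure_congr hae, Measure.prod_apply hmeas', ← integral_toReal
    (measurable_measure_prodMk_left hmeas').aemeasurable (ae_of_all _ fun _ => measure_lt_top _ _)]
  refine integral_congr_ae ?_
  filter_upwards [hL.nonneg t] with ω hω
  exact pi_expMeasure_real x hω

end Reliability

/-! ### Signature and reliability polynomial -/

namespace Reliability

theorem workingProportion_zero {Ω : Type*} [MeasurableSpace Ω] {μ : Measure Ω} {n : ℕ}
    {Φ : Ω → StructureFunction n} (hΦ : IsMixedCoherent Φ μ) (hn : 0 < n) :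
    workingProportion Φ μ 0 = 0 := by
  rw [workingProportion, Finset.sum_eq_zero, zero_div]
  intro x hx
  have hx' : x = fun _ => false := by
    funext i
    have h := Finset.filter_eq_empty_iff.1
      (Finset.card_eq_zero.1 (Finset.mem_filter.1 hx).2) (Finset.mem_univ i)
    simpa using h
  refine integral_eq_zero_of_ae ?_
  filter_upwards [hΦ.coherent] with ω hω
  simp [hx', hω.apply_false hn]

theorem sum_Icc_eq_mul_powerSum (c b : ℝ) (n : ℕ) :
    ∑ k ∈ Finset.Icc 1 n, c * (k : ℝ) ^ (b - 1) = c * powerSum b n := by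
  induction n with
  | zero => simp [powerSum]
  | succ n ih =>
    rw [Finset.sum_Icc_succ_top (by omega), ih, powerSum_succ]
    push_cast
    ring

/-- With a power-law signature, `φ_m = 1 - S_{n-m} / S_n`, where `S` is the power sum. -/
theorem workingProportion_eq {Ω : Type*} [MeasurableSpace Ω] {μ : Measure Ω} {n : ℕ}
    {Φ : Ω → StructureFunction n} (hΦ : IsMixedCoherent Φ μ) (hn : 0 < n) {b c : ℝ}
    (hc : ∑ k ∈ Finset.Icc 1 n, c * (k : ℝ) ^ (b - 1) = 1)
    (hs : ∀ k ∈ Finset.Icc 1 n, signature Φ μ k = c * (k : ℝ) ^ (b - 1)) {m : ℕ} (hm : m ≤ n) :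
    workingProportion Φ μ m = 1 - powerSum b (n - m) / powerSum b n := by
  rw [sum_Icc_eq_mul_powerSum] at hc
  have hS := powerSum_pos b hn
  have hc' : c = 1 / powerSum b n := by rw [eq_div_iff hS.ne', hc]
  induction m with
  | zero => rw [workingProportion_zero hΦ hn, Nat.sub_zero, div_self hS.ne', sub_self]
  | succ m ih =>
    -- The entry `k = n - m` of the signature is `φ_{m+1} - φ_m`.
    have h := hs (n - m) (Finset.mem_Icc.2 ⟨by omega, by omega⟩)
    have hsub : n - m = n - (m + 1) + 1 := by omega
    have h1 : n - (n - m) = m := by omega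
    have h2 := powerSum_succ b (n - (m + 1))
    rw [← hsub] at h2
    rw [signature, h1, ih (by omega), h2, hsub, hc'] at h
    push_cast at h
    field_simp at h ⊢
    linarith

/-- The reliability function of a mixed system whose structure function is independent of the
component failure times. -/
theorem measureReal_lt_systemFailureTime {Ω : Type*} [MeasurableSpace Ω] {μ : Measure Ω}
    [IsProbabilityMeasure μ] {n : ℕ} {Φ : Ω → StructureFunction n} {T : Ω → Fin n → ℝ≥0∞}
    (hΦ : IsMixedCoherent Φ μ) (hT : AEMeasurable T μ) (hΦT : IndepFun Φ T μ) (t : ℝ≥0) :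
    μ.real {ω | (t : ℝ≥0∞) < systemFailureTime (Φ ω) (T ω)} =
      ∑ x : Fin n → Bool, (∫ ω, (if Φ ω x = true then (1 : ℝ) else 0) ∂μ) *
        (μ.map T).real {τ | (fun i => decide ((t : ℝ≥0∞) < τ i)) = x} := by
  have hX := measurable_workingComponents n (t : ℝ≥0∞)
  set X : (Fin n → ℝ≥0∞) → Fin n → Bool := fun τ i => decide ((t : ℝ≥0∞) < τ i) with hXdef
  have hA (x : Fin n → Bool) : MeasurableSet {φ : StructureFunction n | φ x = true} :=
    (measurable_pi_apply x : Measurable fun φ : StructureFunction n => φ x)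
      (measurableSet_singleton true)
  have hB (x : Fin n → Bool) : MeasurableSet {τ | X τ = x} := hX (measurableSet_singleton x)
  have hae : {ω | (t : ℝ≥0∞) < systemFailureTime (Φ ω) (T ω)} =ᵐ[μ]
      ⋃ x ∈ (Finset.univ : Finset (Fin n → Bool)),
        Φ ⁻¹' {φ | φ x = true} ∩ T ⁻¹' {τ | X τ = x} := by
    filter_upwards [hΦ.coherent] with ω hω
    apply propext
    change (t : ℝ≥0∞) < systemFailureTime (Φ ω) (T ω) ↔
      ω ∈ ⋃ x ∈ (Finset.univ : Finset (Fin n → Bool)),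
        Φ ⁻¹' {φ | φ x = true} ∩ T ⁻¹' {τ | X τ = x}
    rw [hω.lt_systemFailureTime_iff _ ENNReal.coe_lt_top]
    simp [hXdef]
  have hdisj : (↑(Finset.univ : Finset (Fin n → Bool)) : Set (Fin n → Bool)).Pairwise
      (Function.onFun (AEDisjoint μ)
        fun x => Φ ⁻¹' {φ | φ x = true} ∩ T ⁻¹' {τ | X τ = x}) := by
    intro x _ y _ hxy
    refine (Set.disjoint_left.2 fun ω hω hω' => hxy ?_).aedisjoint
    exact (show X (T ω) = x from hω.2).symm.trans hω'.2
  rw [measureReal_congr hae, measureReal_biUnion_finset₀ hdisj fun x _ =>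
    (hΦ.measurable (hA x)).nullMeasurableSet.inter (hT.nullMeasurableSet_preimage (hB x))]
  refine Finset.sum_congr rfl fun x _ => ?_
  rw [measureReal_def, hΦT.measure_inter_preimage_eq_mul _ _ (hA x) (hB x), ENNReal.toReal_mul,
    map_measureReal_apply_of_aemeasurable hT (hB x)]
  congr 1
  have : (fun ω => if Φ ω x = true then (1 : ℝ) else 0) =
      (Φ ⁻¹' {φ | φ x = true}).indicator 1 := by
    ext ω
    simp [Set.indicator_apply]
  rw [this, integral_indicator_one (hΦ.measurable (hA x)), measureReal_def]

/-- The reliability of the system, conditionally on `exp (-L t) = p`, summed over the number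
of working components. -/
theorem sum_config_eq_sum_workingProportion {Ω : Type*} [MeasurableSpace Ω] (μ : Measure Ω)
    {n : ℕ} (Φ : Ω → StructureFunction n) (p : ℝ) :
    ∑ x : Fin n → Bool, (∫ ω, (if Φ ω x = true then (1 : ℝ) else 0) ∂μ) *
        (p ^ (Finset.univ.filter fun i => x i = true).card *
          (1 - p) ^ (n - (Finset.univ.filter fun i => x i = true).card)) =
      ∑ m ∈ Finset.range (n + 1),
        workingProportion Φ μ m * ((n.choose m : ℝ) * (p ^ m * (1 - p) ^ (n - m))) := by
  have hmaps : ∀ x ∈ (Finset.univ : Finset (Fin n → Bool)),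
      (Finset.univ.filter fun i => x i = true).card ∈ Finset.range (n + 1) := fun x _ => by
    rw [Finset.mem_range, Nat.lt_succ_iff]
    exact (Finset.card_le_univ _).trans_eq (Fintype.card_fin n)
  rw [← Finset.sum_fiberwise_of_maps_to hmaps]
  refine Finset.sum_congr rfl fun m hm => ?_
  have hch : (n.choose m : ℝ) ≠ 0 := by
    exact_mod_cast (Nat.choose_pos (Nat.lt_succ_iff.1 (Finset.mem_range.1 hm))).ne'
  rw [workingProportion, ← mul_assoc, div_mul_cancel₀ _ hch, Finset.sum_mul]
  refine Finset.sum_congr rfl fun x hx => ?_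
  rw [(Finset.mem_filter.1 hx).2]

/-- The reflection `i = n - m` passes from working to failed components; the leading `1` is the
binomial theorem for `p + (1 - p)`. -/
theorem sum_workingProportion_eq {Ω : Type*} [MeasurableSpace Ω] {μ : Measure Ω} {n : ℕ}
    {Φ : Ω → StructureFunction n} (hΦ : IsMixedCoherent Φ μ) (hn : 0 < n) {b c : ℝ}
    (hc : ∑ k ∈ Finset.Icc 1 n, c * (k : ℝ) ^ (b - 1) = 1)
    (hs : ∀ k ∈ Finset.Icc 1 n, signature Φ μ k = c * (k : ℝ) ^ (b - 1)) (p : ℝ) :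
    ∑ m ∈ Finset.range (n + 1),
        workingProportion Φ μ m * ((n.choose m : ℝ) * (p ^ m * (1 - p) ^ (n - m))) =
      1 - ∑ i ∈ Finset.range (n + 1), powerSum b i / powerSum b n *
        ((n.choose i : ℝ) * (1 - p) ^ i * (1 - (1 - p)) ^ (n - i)) := by
  have h1 : ∑ m ∈ Finset.range (n + 1), (n.choose m : ℝ) * (p ^ m * (1 - p) ^ (n - m)) = 1 := by
    have := add_pow p (1 - p) n
    rw [add_sub_cancel, one_pow] at this
    exact (Finset.sum_congr rfl fun m _ => mul_comm _ _).trans this.symm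
  rw [← Finset.sum_range_reflect (fun i => powerSum b i / powerSum b n * _), eq_sub_iff_add_eq,
    ← Finset.sum_add_distrib]
  refine Eq.trans ?_ h1
  refine Finset.sum_congr rfl fun m hm => ?_
  have hm' : m ≤ n := Nat.lt_succ_iff.1 (Finset.mem_range.1 hm)
  have h2 : n + 1 - 1 - m = n - m := by omega
  have h3 : n - (n - m) = m := by omega
  rw [workingProportion_eq hΦ hn hc hs hm', h2, h3, Nat.choose_symm hm']
  ring

end Reliability

/-! ### Passage to the limit -/

theorem mainTheorem4
    {Ω : Type*} [MeasurableSpace Ω] (P : Measure Ω) [IsProbabilityMeasure P]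
    (L : ℝ≥0 → Ω → ℝ) (hL : IsLevySubordinator L P)
    (b : ℝ) (hb : 0 < b)
    (C : ℕ → ℝ) (hC : ∀ n : ℕ, 2 ≤ n → ∑ k ∈ Finset.Icc 1 n, C n * (k : ℝ) ^ (b - 1) = 1)
    (Ω' : ℕ → Type*) [∀ n, MeasurableSpace (Ω' n)]
    (μ : ∀ n, Measure (Ω' n)) [∀ n, IsProbabilityMeasure (μ n)]
    (Φ : ∀ n, Ω' n → StructureFunction n)
    (T : ∀ n, Ω' n → Fin n → ℝ≥0∞)
    (hΦ : ∀ n : ℕ, 2 ≤ n → IsMixedCoherent (Φ n) (μ n))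
    (hs : ∀ n : ℕ, 2 ≤ n → ∀ k ∈ Finset.Icc 1 n,
      signature (Φ n) (μ n) k = C n * (k : ℝ) ^ (b - 1))
    (hT : ∀ n : ℕ, 2 ≤ n → HasLaw (T n) (lfmoLaw L P n) (μ n))
    (hΦT : ∀ n : ℕ, 2 ≤ n → IndepFun (Φ n) (T n) (μ n))
    (t : ℝ≥0) (ht : 0 < t) :
    Tendsto
      (fun n : ℕ => (μ n).real {ω | (t : ℝ≥0∞) < systemFailureTime (Φ n ω) (T n ω)})
      atTop (𝓝 (1 - ∫ ω, (1 - Real.exp (-L t ω)) ^ b ∂P)) := by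
  let q : Ω → ℝ := fun ω => 1 - Real.exp (-L t ω)
  have hqm : Measurable q := measurable_const.sub (hL.measurable t).neg.exp
  have hq : ∀ᵐ ω ∂P, q ω ∈ Set.Icc (0 : ℝ) 1 := by
    filter_upwards [hL.nonneg t] with ω hω
    have h1 : Real.exp (-L t ω) ≤ 1 := Real.exp_le_one_iff.2 (by linarith)
    have h2 := Real.exp_pos (-L t ω)
    exact ⟨by simp only [q]; linarith, by simp only [q]; linarith⟩
  let B : ℕ → ℝ → ℝ := fun n y => ∑ i ∈ Finset.range (n + 1),
    powerSum b i / powerSum b n * ((n.choose i : ℝ) * y ^ i * (1 - y) ^ (n - i))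
  have hBint (n : ℕ) : Integrable (fun ω => B n (q ω)) P := by
    refine integrable_finsetSum _ fun i _ => Integrable.of_bound
      (C := |powerSum b i / powerSum b n| * (n.choose i : ℝ)) ?_ ?_
    · fun_prop
    · filter_upwards [hq] with ω hω
      rw [norm_mul, Real.norm_eq_abs, mul_assoc, norm_mul, Real.norm_natCast]
      refine mul_le_mul_of_nonneg_left (mul_le_of_le_one_right (Nat.cast_nonneg _) ?_)
        (abs_nonneg _)
      rw [Real.norm_of_nonneg (mul_nonneg (pow_nonneg hω.1 _)
        (pow_nonneg (sub_nonneg.2 hω.2) _))]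
      exact mul_le_one₀ (pow_le_one₀ hω.1 hω.2) (pow_nonneg (sub_nonneg.2 hω.2) _)
        (pow_le_one₀ (sub_nonneg.2 hω.2) (by linarith [hω.1]))
  have hpint : Integrable (fun ω => q ω ^ b) P := by
    refine Integrable.of_bound (C := 1) (hqm.pow_const b).aestronglyMeasurable ?_
    filter_upwards [hq] with ω hω
    rw [Real.norm_of_nonneg (Real.rpow_nonneg hω.1 _)]
    exact Real.rpow_le_one hω.1 hω.2 hb.le
  have hlim : Tendsto (fun n => ∫ ω, B n (q ω) ∂P) atTop (𝓝 (∫ ω, q ω ^ b ∂P)) := by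
    rw [Metric.tendsto_nhds]
    intro ε hε
    filter_upwards [Metric.tendstoUniformlyOn_iff.1 (tendstoUniformlyOn_powerSum_bernstein hb)
      (ε / 2) (half_pos hε)] with n hn
    rw [dist_eq_norm, ← integral_sub (hBint n) hpint]
    -- Integration weakens the pointwise strict bound to `≤`; starting from `ε / 2` restores
    -- strictness.
    refine (norm_integral_le_of_norm_le_const (C := ε / 2) ?_).trans_lt ?_
    · filter_upwards [hq] with ω hω
      rw [← dist_eq_norm, dist_comm]
      exact (hn _ hω).le
    · simpa using hε
  refine (hlim.const_sub 1).congr' ?_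
  filter_upwards [eventually_ge_atTop 2] with n hn
  have hn0 : 0 < n := by omega
  rw [measureReal_lt_systemFailureTime (hΦ n hn) (hT n hn).aemeasurable (hΦT n hn) t,
    (hT n hn).map_eq]
  simp_rw [lfmoLaw_real_workingComponents hL t, ← integral_const_mul]
  rw [← integral_finsetSum]
  · simp_rw [sum_config_eq_sum_workingProportion,
      sum_workingProportion_eq (hΦ n hn) hn0 (hC n hn) (hs n hn)]
    rw [integral_sub (integrable_const _) (hBint n)]
    simp [B, q]
  · intro x _
    refine (Integrable.of_bound (C := 1) ?_ ?_).const_mul _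
    · have := hL.measurable t
      fun_prop
    · filter_upwards [hq] with ω hω
      have h0 := (Real.exp_pos (-L t ω)).le
      have h1 : Real.exp (-L t ω) ≤ 1 := by have := hω.1; simp only [q] at this; linarith
      rw [Real.norm_of_nonneg (mul_nonneg (pow_nonneg h0 _) (pow_nonneg hω.1 _))]
      exact mul_le_one₀ (pow_le_one₀ h0 h1) (pow_nonneg hω.1 _) (pow_le_one₀ hω.1 hω.2)
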